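/- For integers $n\ge 1$, $B_0$ and $B_1,\dots,B_n$ let $M(B_0;B_1,\dots,B_n)$ be the $(n+1)\times(n+1)$ integer matrix whose first row is $(B_0,-B_1,\dots,-B_n)$ and whose remaining rows are $(0\mid I_n)$. By the output of the LLL algorithm on this matrix we mean the first vector of the basis with which the algorithm of Lenstra, Lenstra and Lovász (parameter $3/4$), started on the columns of the matrix in the given order, terminates. For every $\epsilon>0$ there is an $n_0(\epsilon)\in\mathbb N$ such that the following holds for all $n>n_0(\epsilon)$ and every fixed $\mathbf e=(e_1,\dots,e_n)\in\{0,1\}^n$. Let $B_1,\dots,B_n$ be independent, each uniformly distributed on the integers in $[1,2^{(1/2+\epsilon)n^2}]$, and let $B_0=\sum_{i=1}^n B_ie_i$. (i) If $\mathbf e\ne 0$, then conditionally on the event $B_0\ge\frac12\sum_{i=1}^n B_i$, with probability at least $1-2^{-\epsilon n^2/2}$ the LLL algorithm on $M(B_0;B_1,\dots,B_n)$ terminates and its output is a nonzero integer multiple of $[0;\mathbf e]$. (ii) Unconditionally, with probability at least $1-2^{-\epsilon n^2/2}$ the method with test-and-flip succeeds: if $B_0\ge\frac12\sum_{i=1}^n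 B_i$, the LLL algorithm on $M(B_0;B_1,\dots,B_n)$ terminates and its output is a nonzero integer multiple of $[0;\mathbf e]$; otherwise, the LLL algorithm on $M(\sum_{i=1}^n B_i-B_0;B_1,\dots,B_n)$ terminates and its output is a nonzero integer multiple of $[0;\mathbf 1-\mathbf e]$, where $\mathbf 1=(1,\dots,1)$. -/

import Mathlib

open scoped BigOperators

noncomputable section

namespace SubsetSumLLL

/-! ## The LLL algorithm on integer vectors, with the classical parameter `3/4` -/

/-- An integer vector, seen in Euclidean space. -/
def toEuclid {N : ℕ} (v : Fin N → ℤ) : EuclideanSpace ℝ (Fin N) :=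
  WithLp.toLp 2 (fun i => (v i : ℝ))

/-- The Gram-Schmidt vectors `b*₀, b*₁, …` (not normalized) of a family of integer vectors. -/
def gs {d N : ℕ} (b : Fin d → Fin N → ℤ) : Fin d → EuclideanSpace ℝ (Fin N) :=
  InnerProductSpace.gramSchmidt ℝ (fun i => toEuclid (b i))

/-- The Gram-Schmidt coefficient `μ i j = ⟨b i, b* j⟩ / ⟨b* j, b* j⟩`. -/
def mu {d N : ℕ} (b : Fin d → Fin N → ℤ) (i j : Fin d) : ℝ :=
  inner ℝ (gs b j) (toEuclid (b i)) / ‖gs b j‖ ^ 2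

/-- If `|μ i j| > 1/2`, subtract from `b i` the multiple `r • b j`, where `r` is the integer
nearest to `μ i j`. -/
def sizeReduce {d N : ℕ} (b : Fin d → Fin N → ℤ) (i j : Fin d) : Fin d → Fin N → ℤ :=
  if |mu b i j| ≤ 1 / 2 then b else Function.update b i (b i - round (mu b i j) • b j)

/-- Size-reduce `b i` successively against `b l` for `l = i - 2, i - 3, …, 0`. -/
def sizeReduceRest {d N : ℕ} (b : Fin d → Fin N → ℤ) (i : Fin d) : Fin d → Fin N → ℤ :=
  ((List.finRange d).reverse.filter (fun l : Fin d => (l : ℕ) + 1 < (i : ℕ))).foldl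
    (fun b' l => sizeReduce b' i l) b

/-- The Lovász condition `‖b* i‖² ≥ (3/4 - μ²) ‖b* j‖²` with `μ = μ i j` (used for `i = j + 1`). -/
def Lovasz {d N : ℕ} (b : Fin d → Fin N → ℤ) (i j : Fin d) : Prop :=
  (3 / 4 - mu b i j ^ 2) * ‖gs b j‖ ^ 2 ≤ ‖gs b i‖ ^ 2

/-- A state of the algorithm: the current position `k` and the current basis. -/
structure LLLState (d N : ℕ) where
  k : ℕ
  b : Fin d → Fin N → ℤ

open Classical in
/-- One round at position `i = j + 1`. Size-reduce `b i` against `b j` and test the Lovász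
condition. If it holds, finish the size reduction of `b i` and move on to position `i + 1`; if it
fails, exchange `b j` and `b i` and step back to position `max 1 (i - 1)`. -/
def lllRound {d N : ℕ} (b : Fin d → Fin N → ℤ) (i j : Fin d) : LLLState d N :=
  if Lovasz (sizeReduce b i j) i j then
    ⟨(i : ℕ) + 1, sizeReduceRest (sizeReduce b i j) i⟩
  else
    ⟨max 1 ((i : ℕ) - 1), fun l => sizeReduce b i j (Equiv.swap i j l)⟩

/-- The main loop: perform rounds at the current position `k`, for as long as `k` is the index of a
vector. Once `k` has run past the last vector, nothing happens any more. -/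
def lllStep {d N : ℕ} (s : LLLState d N) : LLLState d N :=
  if h : 1 ≤ s.k ∧ s.k < d then
    lllRound s.b ⟨s.k, h.2⟩ ⟨s.k - 1, by omega⟩
  else s

/-- The LLL algorithm, started on the basis `b 0, …, b n`, terminates, and `v` is the first vector
of the basis that it ends with. -/
def LLLReturns {n N : ℕ} (b : Fin (n + 1) → Fin N → ℤ) (v : Fin N → ℤ) : Prop :=
  ∃ t : ℕ, n + 1 ≤ (lllStep^[t] (⟨1, b⟩ : LLLState (n + 1) N)).k ∧
    (lllStep^[t] (⟨1, b⟩ : LLLState (n + 1) N)).b 0 = v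

/-! ## The subset sum lattice -/

/-- The `(n + 1) × (n + 1)` matrix with first row `(B₀, -B₁, …, -Bₙ)`, whose rows below the first
are `(0 | I)` with `I` the `n × n` identity matrix. -/
def latticeMatrix {n : ℕ} (B₀ : ℤ) (B : Fin n → ℤ) : Matrix (Fin (n + 1)) (Fin (n + 1)) ℤ :=
  Matrix.of (Fin.cons (Fin.cons B₀ (fun j => -B j))
    (fun i => Fin.cons 0 ((1 : Matrix (Fin n) (Fin n) ℤ) i)))

/-- The LLL algorithm, run on the columns of the lattice matrix, terminates and returns a nonzero
integer multiple of `[0; e]`. -/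
def LLLFinds {n : ℕ} (B₀ : ℤ) (B : Fin n → ℤ) (e : Fin n → ℤ) : Prop :=
  ∃ v : Fin (n + 1) → ℤ, LLLReturns (fun j => (latticeMatrix B₀ B).col j) v ∧
    ∃ k : ℤ, k ≠ 0 ∧ v = k • (Fin.cons 0 e : Fin (n + 1) → ℤ)

/-- The target `B₀ = ∑ Bᵢ eᵢ`. -/
def target {n : ℕ} (e B : Fin n → ℤ) : ℤ := ∑ i, B i * e i

/-- The condition `B₀ ≥ (1/2) ∑ Bᵢ`. -/
def HalfCondition {n : ℕ} (e B : Fin n → ℤ) : Prop :=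
  (1 / 2 : ℝ) * ∑ i, (B i : ℝ) ≤ (target e B : ℝ)

/-- The joint law of independent `B₁, …, Bₙ`, each uniform on the integers in
`[1, 2 ^ ((1/2 + ε) n²)]`. -/
def inputLaw (n : ℕ) (ε : ℝ) : MeasureTheory.Measure (Fin n → ℤ) :=
  MeasureTheory.Measure.pi (fun _ : Fin n => ProbabilityTheory.uniformOn
    (Set.Icc (1 : ℤ) ⌊(2 : ℝ) ^ ((1 / 2 + ε) * (n : ℝ) ^ 2)⌋))

end SubsetSumLLL

end

/-!
The proof is that of Lagarias and Odlyzko, as simplified by Frieze.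

The LLL algorithm. Let `b*₀, b*₁, …` be the Gram-Schmidt vectors. Size reduction changes neither
them nor the lattice. An exchange at a failure of the Lovász condition shortens `b*ⱼ` for the smaller
index `j` by a constant factor, and changes only one of the Gram determinants
`∏ l < m, ‖b*ₗ‖²`, namely that with `m = j + 1`. Since Gram determinants of integer vectors are
integers, and positive on a basis, their sum is a natural number that each exchange decreases,
which gives termination. In the final basis `‖b*₀‖² ≤ 2 ^ m ‖b*ₘ‖²` for all `m`, and each
nonzero lattice vector is at least as long as some `b*ₘ`; so the output is a nonzero lattice vector
of length at most `2 ^ (n / 2)` times that of any other (`exists_lllReturns`).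

The subset sum lattice. It contains `(0; e)`, so the output `(w; x)` has all entries at most
`R = n 2 ^ (n / 2)` in absolute value, and `w = y B₀ - ∑ xᵢ Bᵢ = ∑ Bᵢ (y eᵢ - xᵢ)` for an integer
`y`. From `B₀ ≥ (1/2) ∑ Bᵢ` it follows that `|y| ≤ 3 R`. If `x = y e` then `w = 0` and the output is
a multiple of `(0; e)`. Otherwise the inputs satisfy a nontrivial linear equation, which for given
`(y, w, x)` has probability at most `1 / M`, where `M` bounds the inputs. There are only
`2 ^ (n² / 2 + O(n log n))` candidates `(y, w, x)`, and `M` is about `2 ^ ((1/2 + ε) n²)`, so that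
the union bound (`card_failures_mul_le`) gives a failure probability of
`2 ^ (-ε n² + O(n log n))`.

Conditioning costs a factor of at most `(4 n) ^ n`, as the condition has probability at least
`(4 n) ^ (-n)` (`card_inputBox_le_mul_card_filter_half`). If the condition fails for `e`, then it
holds for `1 - e`, which gives the unconditional statement with twice the failure probability.
-/

namespace SubsetSumLLL

/-! ### Gram-Schmidt vectors and Gram determinants of integer vectors -/

variable {d N : ℕ}

lemma toEuclid_sub_smul (u v : Fin N → ℤ) (r : ℤ) :
    toEuclid (u - r • v) = toEuclid u - (r : ℝ) • toEuclid v := by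
  ext i; simp [toEuclid]

lemma inner_toEuclid (u v : Fin N → ℤ) :
    inner ℝ (toEuclid u) (toEuclid v) = ((u ⬝ᵥ v : ℤ) : ℝ) := by
  simp [toEuclid, dotProduct, PiLp.inner_apply, mul_comm]

lemma toEuclid_eq_add_sum (b : Fin d → Fin N → ℤ) (i : Fin d) :
    toEuclid (b i) = gs b i + ∑ l ∈ Finset.Iio i, mu b i l • gs b l :=
  InnerProductSpace.gramSchmidt_def'' ℝ (fun i => toEuclid (b i)) i

lemma gs_orthogonal (b : Fin d → Fin N → ℤ) {i j : Fin d} (h : i ≠ j) :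
    inner ℝ (gs b i) (gs b j) = 0 :=
  InnerProductSpace.gramSchmidt_orthogonal ℝ _ h

lemma inner_gs_of_lt (b : Fin d → Fin N → ℤ) {i j : Fin d} (h : i < j) :
    inner ℝ (gs b j) (toEuclid (b i)) = 0 :=
  InnerProductSpace.gramSchmidt_inv_triangular ℝ _ h

lemma inner_gs_self (b : Fin d → Fin N → ℤ) (i : Fin d) :
    inner ℝ (gs b i) (toEuclid (b i)) = ‖gs b i‖ ^ 2 := by
  rw [toEuclid_eq_add_sum, inner_add_right, inner_sum, Finset.sum_eq_zero,
    add_zero, real_inner_self_eq_norm_sq]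
  intro l hl
  rw [inner_smul_right, gs_orthogonal b (Finset.mem_Iio.1 hl).ne', mul_zero]

/-- The Gram-Schmidt vector `b* i` depends only on the vectors `b l` with `l ≤ i`. -/
lemma gs_congr {b b' : Fin d → Fin N → ℤ} {i : Fin d} (h : ∀ l ≤ i, b' l = b l) :
    gs b' i = gs b i := by
  induction i using WellFoundedLT.induction with
  | ind i ih =>
    have h1 := toEuclid_eq_add_sum b i
    have h2 := toEuclid_eq_add_sum b' i
    have h3 : ∑ l ∈ Finset.Iio i, mu b' i l • gs b' l = ∑ l ∈ Finset.Iio i, mu b i l • gs b l := by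
      refine Finset.sum_congr rfl fun l hl => ?_
      have hl := Finset.mem_Iio.1 hl
      simp only [mu, ih l hl fun m hm => h m (hm.trans hl.le), h i le_rfl]
    rw [h i le_rfl, h3, h1] at h2
    exact (add_right_cancel h2).symm

lemma mu_congr {b b' : Fin d → Fin N → ℤ} {i j : Fin d} (hi : b' i = b i)
    (hj : gs b' j = gs b j) : mu b' i j = mu b i j := by
  simp only [mu, hi, hj]

lemma lovasz_congr {b b' : Fin d → Fin N → ℤ} {i j : Fin d} (hmu : mu b' i j = mu b i j)
    (hi : gs b' i = gs b i) (hj : gs b' j = gs b j) : Lovasz b' i j ↔ Lovasz b i j := by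
  simp only [Lovasz, hi, hj, hmu]

lemma mu_update_sub (b b' : Fin d → Fin N → ℤ) (i j l : Fin d) (r : ℤ)
    (hb' : b' i = b i - r • b j) (hl : gs b' l = gs b l) :
    mu b' i l = mu b i l - r * mu b j l := by
  simp only [mu, hb', hl, toEuclid_sub_smul, inner_sub_right, inner_smul_right]
  ring

lemma mu_self {b : Fin d → Fin N → ℤ} {j : Fin d} (h : gs b j ≠ 0) : mu b j j = 1 := by
  rw [mu, inner_gs_self, div_self]
  positivity

lemma mu_of_lt (b : Fin d → Fin N → ℤ) {i j : Fin d} (h : i < j) : mu b i j = 0 := by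
  rw [mu, inner_gs_of_lt b h, zero_div]

lemma toEuclid_eq_sum_Iio_smul_gs (b : Fin d → Fin N → ℤ) {i j : Fin d} (h : j < i) :
    toEuclid (b j) = ∑ l ∈ Finset.Iio i, mu b j l • gs b l := by
  -- `mu b j j = 1` fails only if `gs b j = 0`, where both sides vanish.
  have hmu : mu b j j • gs b j = gs b j := by
    by_cases h0 : gs b j = 0
    · simp [h0]
    · rw [mu_self h0, one_smul]
  rw [toEuclid_eq_add_sum]
  conv_lhs => rw [← hmu]
  rw [← Finset.sum_insert (f := fun l => mu b j l • gs b l) (by simp)]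
  refine Finset.sum_subset ?_ ?_
  · intro l hl
    simp only [Finset.mem_insert, Finset.mem_Iio] at hl ⊢
    rcases hl with rfl | hl
    · exact h
    · exact hl.trans h
  · intro l _ hl'
    simp only [Finset.mem_insert, Finset.mem_Iio, not_or, not_lt] at hl'
    rw [mu_of_lt b (lt_of_le_of_ne hl'.2 (Ne.symm hl'.1)), zero_smul]

/-- Subtracting a multiple of an earlier vector from `b i` does not change the Gram-Schmidt
vectors. -/
lemma gs_update_sub (b : Fin d → Fin N → ℤ) {i j : Fin d} (h : j < i) (r : ℤ) :
    gs (Function.update b i (b i - r • b j)) = gs b := by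
  set b' := Function.update b i (b i - r • b j) with hb'
  funext m
  induction m using WellFoundedLT.induction with
  | ind m ih =>
    have h2 := toEuclid_eq_add_sum b' m
    by_cases hm : m = i
    · subst hm
      have hbm : b' m = b m - r • b j := by simp [hb']
      have h3 : ∑ l ∈ Finset.Iio m, mu b' m l • gs b' l
          = ∑ l ∈ Finset.Iio m, mu b m l • gs b l
            - (r : ℝ) • ∑ l ∈ Finset.Iio m, mu b j l • gs b l := by
        rw [Finset.smul_sum, ← Finset.sum_sub_distrib]
        refine Finset.sum_congr rfl fun l hl => ?_
        have hl := ih l (Finset.mem_Iio.1 hl)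
        rw [mu_update_sub b b' m j l r hbm hl, hl, sub_smul, smul_smul]
      rw [hbm, h3, toEuclid_sub_smul, toEuclid_eq_add_sum b m, toEuclid_eq_sum_Iio_smul_gs b h,
        add_sub_assoc] at h2
      exact (add_right_cancel h2).symm
    · have hbm : b' m = b m := by simp [hb', hm]
      have h3 : ∑ l ∈ Finset.Iio m, mu b' m l • gs b' l
          = ∑ l ∈ Finset.Iio m, mu b m l • gs b l := by
        refine Finset.sum_congr rfl fun l hl => ?_
        have hl := ih l (Finset.mem_Iio.1 hl)
        rw [mu_congr hbm hl, hl]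
      rw [hbm, h3, toEuclid_eq_add_sum b m] at h2
      exact (add_right_cancel h2).symm

/-- The Gram determinant of the first `m` vectors of a family of integer vectors. -/
def gramDet (b : Fin d → Fin N → ℤ) (m : ℕ) : ℤ :=
  (Matrix.of fun a c : {l : Fin d // (l : ℕ) < m} => b a ⬝ᵥ b c).det

/-- The Gram matrix is `U D Uᵀ`, where `U` is unitriangular, with the Gram-Schmidt coefficients as
entries, and `D` is diagonal with entries `‖b* a‖²`. -/
lemma gramDet_eq_prod (b : Fin d → Fin N → ℤ) (m : ℕ) :
    (gramDet b m : ℝ) = ∏ a : {l : Fin d // (l : ℕ) < m}, ‖gs b a‖ ^ 2 := by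
  classical
  let U : Matrix {l : Fin d // (l : ℕ) < m} {l : Fin d // (l : ℕ) < m} ℝ :=
    Matrix.of fun a c => if c = a then 1 else mu b a c
  have hU : ∀ a : {l : Fin d // (l : ℕ) < m}, toEuclid (b a) = ∑ c, U a c • gs b c := by
    intro a
    rw [toEuclid_eq_add_sum, ← Finset.add_sum_erase _ _ (Finset.mem_univ a)]
    congr 1
    · simp [U]
    · have hc : ∑ c ∈ Finset.univ.erase a, U a c • gs b c
          = ∑ c ∈ Finset.univ.filter (fun c : {l : Fin d // (l : ℕ) < m} => c < a),
              mu b a c • gs b c := by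
        symm
        rw [Finset.sum_subset (s₂ := Finset.univ.erase a)]
        · refine Finset.sum_congr rfl fun c hc => ?_
          simp [U, Finset.ne_of_mem_erase hc]
        · intro c hc
          simp only [Finset.mem_filter, Finset.mem_univ, true_and] at hc
          simp [hc.ne]
        · intro c hc hc'
          simp only [Finset.mem_filter, Finset.mem_univ, true_and, not_lt] at hc'
          rw [mu_of_lt b (lt_of_le_of_ne hc'
            fun h => Finset.ne_of_mem_erase hc (Subtype.ext h).symm), zero_smul]
      rw [hc]
      symm
      refine Finset.sum_bij (fun c _ => (c : Fin d)) ?_ ?_ ?_ ?_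
      · intro c hc
        simpa using hc
      · intro c _ c' _ h
        exact Subtype.ext h
      · intro l hl
        have hl := Finset.mem_Iio.1 hl
        exact ⟨⟨l, lt_trans (Fin.lt_def.1 hl) a.2⟩, by simpa [← Subtype.coe_lt_coe] using hl, rfl⟩
      · intro c _
        rfl
  have hG : (Matrix.of fun a c : {l : Fin d // (l : ℕ) < m} => b a ⬝ᵥ b c).map
      (Int.castRingHom ℝ) = U * Matrix.diagonal
        (fun a : {l : Fin d // (l : ℕ) < m} => ‖gs b a‖ ^ 2) * U.transpose := by
    ext a c
    simp only [Matrix.map_apply, Matrix.of_apply, eq_intCast, ← inner_toEuclid, hU a, hU c]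
    rw [Matrix.mul_apply]
    simp only [sum_inner, inner_sum, inner_smul_left, inner_smul_right, Matrix.mul_diagonal,
      Matrix.transpose_apply]
    refine Finset.sum_congr rfl fun x _ => ?_
    rw [Finset.sum_eq_single x]
    · simp only [real_inner_self_eq_norm_sq, conj_trivial]
      ring
    · intro y _ hy
      rw [gs_orthogonal b (fun h => hy (Subtype.ext h))]
      simp
    · simp
  have hdet : U.det = 1 := by
    have ht : U.transpose.IsUpperTriangular := by
      intro a c hac
      have hac : c < a := hac
      simp only [Matrix.transpose_apply, U, Matrix.of_apply, if_neg hac.ne']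
      exact mu_of_lt b hac
    rw [← Matrix.det_transpose, Matrix.det_of_isUpperTriangular ht]
    simp [U]
  rw [gramDet, ← eq_intCast (Int.castRingHom ℝ), RingHom.map_det, RingHom.mapMatrix_apply, hG,
    Matrix.det_mul, Matrix.det_mul, Matrix.det_transpose, hdet, Matrix.det_diagonal]
  ring

lemma gramDet_congr {b b' : Fin d → Fin N → ℤ} (h : gs b' = gs b) (m : ℕ) :
    gramDet b' m = gramDet b m := by
  have : (gramDet b' m : ℝ) = gramDet b m := by rw [gramDet_eq_prod, gramDet_eq_prod, h]
  exact_mod_cast this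

lemma gramDet_succ (b : Fin d → Fin N → ℤ) (j : Fin d) :
    (gramDet b (j + 1) : ℝ) = gramDet b j * ‖gs b j‖ ^ 2 := by
  have key : ∀ m : ℕ, (gramDet b m : ℝ)
      = ∏ a ∈ Finset.univ.filter (fun l : Fin d => (l : ℕ) < m), ‖gs b a‖ ^ 2 := fun m => by
    rw [gramDet_eq_prod]
    exact (Finset.prod_subtype (Finset.univ.filter (fun l : Fin d => (l : ℕ) < m))
      (by simp) (fun a => ‖gs b a‖ ^ 2)).symm
  have hins : Finset.univ.filter (fun l : Fin d => (l : ℕ) < j + 1)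
      = insert j (Finset.univ.filter (fun l : Fin d => (l : ℕ) < j)) := by
    ext l
    simp only [Finset.mem_filter, Finset.mem_univ, true_and, Finset.mem_insert, Fin.ext_iff]
    omega
  rw [key, key, hins, Finset.prod_insert (by simp), mul_comm]

lemma gramDet_pos {b : Fin d → Fin N → ℤ} (h : ∀ l, gs b l ≠ 0) (m : ℕ) : 0 < gramDet b m := by
  have : (0 : ℝ) < gramDet b m := by
    rw [gramDet_eq_prod]
    refine Finset.prod_pos fun a _ => ?_
    have := h a
    positivity
  exact_mod_cast this

/-- Exchanging two adjacent vectors permutes the first `m` vectors, except when `m` separates the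
two, and so keeps the Gram determinant. -/
lemma gramDet_swap (b : Fin d → Fin N → ℤ) {i j : Fin d} (hij : (i : ℕ) = j + 1) {m : ℕ}
    (hm : m ≠ j + 1) : gramDet (fun l => b (Equiv.swap i j l)) m = gramDet b m := by
  have hp : ∀ l : Fin d, ((Equiv.swap i j l : Fin d) : ℕ) < m ↔ (l : ℕ) < m := by
    intro l
    rcases eq_or_ne l i with rfl | hi
    · rw [Equiv.swap_apply_left]; omega
    rcases eq_or_ne l j with rfl | hj
    · rw [Equiv.swap_apply_right]; omega
    rw [Equiv.swap_apply_of_ne_of_ne hi hj]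
  rw [gramDet, gramDet, ← Matrix.det_submatrix_equiv_self ((Equiv.swap i j).subtypePerm hp)
    (Matrix.of fun a c : {l : Fin d // (l : ℕ) < m} => b a ⬝ᵥ b c)]
  rfl

lemma gs_ne_zero_of_gramDet_ne_zero {b : Fin d → Fin N → ℤ} (h : gramDet b d ≠ 0) (l : Fin d) :
    gs b l ≠ 0 := by
  have : (gramDet b d : ℝ) ≠ 0 := by exact_mod_cast h
  rw [gramDet_eq_prod, Finset.prod_ne_zero_iff] at this
  simpa using this ⟨l, l.2⟩ (Finset.mem_univ _)

/-- After an exchange of `b j` and `b i`, `i = j + 1`, the new vector `b* j` is the component of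
`b i` orthogonal to the vectors before `b j`. -/
lemma gs_swap (b : Fin d → Fin N → ℤ) {i j : Fin d} (hij : (i : ℕ) = j + 1) :
    gs (fun l => b (Equiv.swap i j l)) j = gs b i + mu b i j • gs b j := by
  set b' : Fin d → Fin N → ℤ := fun l => b (Equiv.swap i j l) with hb'
  have hji : j < i := by rw [Fin.lt_def]; omega
  have h1 := toEuclid_eq_add_sum b i
  have h2 := toEuclid_eq_add_sum b' j
  have hbj : b' j = b i := by simp [hb']
  have hlow : ∀ l < j, gs b' l = gs b l := fun l hl => gs_congr fun m hm => by
    have hmj := hm.trans_lt hl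
    simp only [hb', Equiv.swap_apply_of_ne_of_ne (hmj.trans hji).ne hmj.ne]
  have h3 : ∑ l ∈ Finset.Iio j, mu b' j l • gs b' l = ∑ l ∈ Finset.Iio j, mu b i l • gs b l := by
    refine Finset.sum_congr rfl fun l hl => ?_
    have hl := hlow l (Finset.mem_Iio.1 hl)
    simp only [mu, hl, hbj]
  have h4 : Finset.Iio i = insert j (Finset.Iio j) := by
    ext l
    simp only [Finset.mem_insert, Finset.mem_Iio, Fin.lt_def, Fin.ext_iff]
    omega
  rw [h4, Finset.sum_insert (by simp), ← add_assoc] at h1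
  rw [hbj, h3, h1] at h2
  exact (add_right_cancel h2).symm

/-! ### Size reduction -/

lemma span_update_sub (b : Fin d → Fin N → ℤ) {i j : Fin d} (h : j ≠ i) (r : ℤ) :
    Submodule.span ℤ (Set.range (Function.update b i (b i - r • b j)))
      = Submodule.span ℤ (Set.range b) := by
  set b' := Function.update b i (b i - r • b j) with hb'
  have hi : b' i = b i - r • b j := by simp [hb']
  have hne : ∀ l, l ≠ i → b' l = b l := fun l hl => by simp [hb', hl]
  have mem : ∀ (c : Fin d → Fin N → ℤ) l, c l ∈ Submodule.span ℤ (Set.range c) := fun c l =>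
    Submodule.subset_span ⟨l, rfl⟩
  apply le_antisymm <;> rw [Submodule.span_le] <;> rintro _ ⟨l, rfl⟩ <;>
    rcases eq_or_ne l i with rfl | hl
  · rw [hi]
    exact Submodule.sub_mem _ (mem b l) (Submodule.smul_mem _ _ (mem b j))
  · rw [hne l hl]
    exact mem b l
  · have : b l = b' l + r • b' j := by rw [hi, hne j h]; abel
    rw [this]
    exact Submodule.add_mem _ (mem b' l) (Submodule.smul_mem _ _ (mem b' j))
  · rw [← hne l hl]
    exact mem b' l

/-- `b'` arises from `b` by a change of the vector `b i` that affects neither the Gram-Schmidt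
vectors nor the lattice. -/
structure ReducedAt (b b' : Fin d → Fin N → ℤ) (i : Fin d) : Prop where
  gs_eq : gs b' = gs b
  apply_ne : ∀ l, l ≠ i → b' l = b l
  span_eq : Submodule.span ℤ (Set.range b') = Submodule.span ℤ (Set.range b)

lemma ReducedAt.refl (b : Fin d → Fin N → ℤ) (i : Fin d) : ReducedAt b b i :=
  ⟨rfl, fun _ _ => rfl, rfl⟩

lemma ReducedAt.trans {b b' b'' : Fin d → Fin N → ℤ} {i : Fin d} (h : ReducedAt b b' i)
    (h' : ReducedAt b' b'' i) : ReducedAt b b'' i :=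
  ⟨h'.gs_eq.trans h.gs_eq, fun l hl => (h'.apply_ne l hl).trans (h.apply_ne l hl),
    h'.span_eq.trans h.span_eq⟩

lemma reducedAt_sizeReduce (b : Fin d → Fin N → ℤ) {i j : Fin d} (h : j < i) :
    ReducedAt b (sizeReduce b i j) i := by
  unfold sizeReduce
  split_ifs
  · exact .refl b i
  · exact ⟨gs_update_sub b h _, fun l hl => by simp [hl], span_update_sub b h.ne _⟩

lemma abs_mu_sizeReduce_le {b : Fin d → Fin N → ℤ} {i j : Fin d} (h : j < i) (h0 : gs b j ≠ 0) :
    |mu (sizeReduce b i j) i j| ≤ 1 / 2 := by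
  unfold sizeReduce
  split_ifs with hmu
  · exact hmu
  · rw [mu_update_sub b _ i j j (round (mu b i j)) (by simp)
      (by rw [gs_update_sub b h]), mu_self h0, mul_one]
    exact abs_sub_round _

lemma mu_sizeReduce_of_lt (b : Fin d → Fin N → ℤ) {i j l : Fin d} (hj : j < i) (hl : l < j) :
    mu (sizeReduce b i l) i j = mu b i j := by
  unfold sizeReduce
  split_ifs
  · rfl
  · rw [mu_update_sub b _ i l j (round (mu b i l)) (by simp)
      (by rw [gs_update_sub b (hl.trans hj)]), mu_of_lt b hl, mul_zero, sub_zero]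

lemma sizeReduceRest_spec (b : Fin d → Fin N → ℤ) {i j : Fin d} (hij : (i : ℕ) = j + 1) :
    ReducedAt b (sizeReduceRest b i) i ∧ mu (sizeReduceRest b i) i j = mu b i j := by
  have key : ∀ L : List (Fin d), (∀ l ∈ L, l < j) → ∀ b : Fin d → Fin N → ℤ,
      ReducedAt b (L.foldl (fun b' l => sizeReduce b' i l) b) i ∧
        mu (L.foldl (fun b' l => sizeReduce b' i l) b) i j = mu b i j := by
    have hji : j < i := by rw [Fin.lt_def]; omega
    intro L
    induction L with
    | nil => exact fun _ b => ⟨.refl b i, rfl⟩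
    | cons l L ih =>
      intro hL b
      have hl : l < j := hL l (by simp)
      obtain ⟨h1, h2⟩ := ih (fun l hl => hL l (by simp [hl])) (sizeReduce b i l)
      exact ⟨(reducedAt_sizeReduce b (hl.trans hji)).trans h1,
        h2.trans (mu_sizeReduce_of_lt b hji hl)⟩
  refine key _ (fun l hl => ?_) b
  simp only [List.mem_filter, decide_eq_true_eq] at hl
  rw [Fin.lt_def]
  omega

/-! ### Correctness and termination of the LLL algorithm -/

/-- The vectors `b 0, …, b (k - 1)` satisfy those conditions of an LLL-reduced basis that bear on
adjacent vectors: `|μ i j| ≤ 1/2` and the Lovász condition, for `i = j + 1`. -/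
def ReducedBelow (b : Fin d → Fin N → ℤ) (k : ℕ) : Prop :=
  ∀ i j : Fin d, (i : ℕ) = j + 1 → (i : ℕ) < k → |mu b i j| ≤ 1 / 2 ∧ Lovasz b i j

/-- The loop invariant of the LLL algorithm started on `b₀`. Linear independence is expressed by
the Gram-Schmidt vectors being nonzero. -/
structure Invariant (b₀ : Fin d → Fin N → ℤ) (s : LLLState d N) : Prop where
  gs_ne_zero : ∀ l, gs s.b l ≠ 0
  span_eq : Submodule.span ℤ (Set.range s.b) = Submodule.span ℤ (Set.range b₀)
  one_le : 1 ≤ s.k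
  le : s.k ≤ d
  reduced : ReducedBelow s.b s.k

/-- The sum of the Gram determinants of all initial segments of the basis. -/
def potential (b : Fin d → Fin N → ℤ) : ℕ :=
  ∑ m ∈ Finset.range (d + 1), (gramDet b m).toNat

lemma ReducedAt.potential_eq {b b' : Fin d → Fin N → ℤ} {i : Fin d} (h : ReducedAt b b' i) :
    potential b' = potential b := by
  simp only [potential, gramDet_congr h.gs_eq]

lemma gs_swap_ne_zero {b : Fin d → Fin N → ℤ} (h0 : ∀ l, gs b l ≠ 0) {i j : Fin d}
    (hij : (i : ℕ) = j + 1) (l : Fin d) : gs (fun l => b (Equiv.swap i j l)) l ≠ 0 := by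
  refine gs_ne_zero_of_gramDet_ne_zero ?_ l
  rw [gramDet_swap b hij (by have := i.2; omega)]
  exact (gramDet_pos h0 d).ne'

/-- If the Lovász condition fails, then the exchange decreases the one Gram determinant that it
changes. -/
lemma potential_swap_lt {b : Fin d → Fin N → ℤ} (h0 : ∀ l, gs b l ≠ 0) {i j : Fin d}
    (hij : (i : ℕ) = j + 1) (hL : ¬ Lovasz b i j) :
    potential (fun l => b (Equiv.swap i j l)) < potential b := by
  set b' : Fin d → Fin N → ℤ := fun l => b (Equiv.swap i j l) with hb'
  have hlt : gramDet b' (j + 1) < gramDet b (j + 1) := by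
    have h1 : ‖gs b' j‖ ^ 2 < ‖gs b j‖ ^ 2 := by
      have horth : inner ℝ (gs b i) (mu b i j • gs b j) = 0 := by
        rw [inner_smul_right, gs_orthogonal b (by rintro rfl; omega), mul_zero]
      rw [hb', gs_swap b hij, sq, norm_add_sq_eq_norm_sq_add_norm_sq_real horth, norm_smul]
      rw [Lovasz, not_le] at hL
      have h2 := abs_mul_abs_self (mu b i j)
      rw [Real.norm_eq_abs]
      nlinarith [sq_nonneg ‖gs b j‖]
    have h2 : (gramDet b' (j + 1) : ℝ) < gramDet b (j + 1) := by
      rw [gramDet_succ, gramDet_succ, hb', gramDet_swap b hij (by omega), ← hb']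
      exact mul_lt_mul_of_pos_left h1 (by exact_mod_cast gramDet_pos h0 j)
    exact_mod_cast h2
  have hpos := gramDet_pos h0 (j + 1)
  refine Finset.sum_lt_sum (fun m _ => ?_) ⟨j + 1, by simp [j.2], by omega⟩
  by_cases hm : m = j + 1
  · subst hm; omega
  · rw [hb', gramDet_swap b hij hm]

/-- One pass through the loop keeps the invariant, and it either decreases the potential or keeps
it and advances. -/
lemma Invariant.step {b₀ : Fin d → Fin N → ℤ} {s : LLLState d N} (h : Invariant b₀ s)
    (hk : s.k < d) :
    Invariant b₀ (lllStep s) ∧ (potential (lllStep s).b < potential s.b ∨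
      potential (lllStep s).b = potential s.b ∧ (lllStep s).k = s.k + 1) := by
  obtain ⟨k, b⟩ := s
  obtain ⟨h0, hspan, h1, -, hred⟩ := h
  simp only at h0 hspan h1 hred hk ⊢
  have hstep : lllStep (⟨k, b⟩ : LLLState d N) = lllRound b ⟨k, hk⟩ ⟨k - 1, by omega⟩ :=
    dif_pos ⟨h1, hk⟩
  rw [hstep]
  set i : Fin d := ⟨k, hk⟩ with hi
  set j : Fin d := ⟨k - 1, by omega⟩ with hj
  have hij : (i : ℕ) = j + 1 := by simp only [hi, hj]; omega
  have hji : j < i := by rw [Fin.lt_def]; omega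
  have hc := reducedAt_sizeReduce b hji
  have hmu := abs_mu_sizeReduce_le hji (h0 j)
  set c := sizeReduce b i j with hcdef
  unfold lllRound
  rw [← hcdef]
  split_ifs with hL
  · obtain ⟨hr, hmur⟩ := sizeReduceRest_spec c hij
    have hbr := hc.trans hr
    refine ⟨⟨fun l => ?_, hbr.span_eq.trans hspan, by simp, hk, ?_⟩,
      Or.inr ⟨hbr.potential_eq, rfl⟩⟩
    · simpa only [hbr.gs_eq] using h0 l
    · intro i' j' hij' hlt
      simp only at hlt ⊢
      rcases eq_or_ne i' i with rfl | hne
      · obtain rfl : j' = j := Fin.ext (by omega)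
        rw [hmur, lovasz_congr hmur (by rw [hr.gs_eq]) (by rw [hr.gs_eq])]
        exact ⟨hmu, hL⟩
      · have hlt' : (i' : ℕ) < k := by
          have : (i' : ℕ) ≠ k := fun h => hne (Fin.ext h)
          simp only [hi] at hlt
          omega
        have hm : mu (sizeReduceRest c i) i' j' = mu b i' j' :=
          mu_congr (hbr.apply_ne i' hne) (by rw [hbr.gs_eq])
        rw [hm, lovasz_congr hm (by rw [hbr.gs_eq]) (by rw [hbr.gs_eq])]
        exact hred i' j' hij' hlt'
  · have hc0 : ∀ l, gs c l ≠ 0 := fun l => by simpa only [hc.gs_eq] using h0 l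
    refine ⟨⟨gs_swap_ne_zero hc0 hij, ?_, le_max_left _ _, ?_, ?_⟩, Or.inl ?_⟩
    · rw [← hspan, ← hc.span_eq]
      exact congrArg _ ((Equiv.swap i j).surjective.range_comp c)
    · simp only [hi]
      omega
    · intro i' j' hij' hlt
      simp only at hlt ⊢
      have hlt' : i' < j := by
        rw [Fin.lt_def]
        simp only [hi, hj] at hlt ⊢
        omega
      have happ : ∀ l < j, c (Equiv.swap i j l) = b l := fun l hl => by
        rw [Equiv.swap_apply_of_ne_of_ne (hl.trans hji).ne hl.ne, hc.apply_ne l (hl.trans hji).ne]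
      have hgs : ∀ l < j, gs (fun l => c (Equiv.swap i j l)) l = gs b l := fun l hl =>
        gs_congr fun m hm => happ m (hm.trans_lt hl)
      have hj' : j' < j := lt_trans (by rw [Fin.lt_def]; omega) hlt'
      have hm : mu (fun l => c (Equiv.swap i j l)) i' j' = mu b i' j' :=
        mu_congr (happ i' hlt') (hgs j' hj')
      rw [hm, lovasz_congr hm (hgs i' hlt') (hgs j' hj')]
      exact hred i' j' hij' (by rw [Fin.lt_def] at hlt'; simp only [hj] at hlt'; omega)
    · rw [← hc.potential_eq]
      exact potential_swap_lt hc0 hij hL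

/-- Termination: the pair of the potential and the distance of the position from the end decreases
lexicographically. -/
lemma Invariant.exists_iterate {b₀ : Fin d → Fin N → ℤ} {s : LLLState d N} (h : Invariant b₀ s) :
    ∃ t : ℕ, d ≤ (lllStep^[t] s).k ∧ Invariant b₀ (lllStep^[t] s) := by
  generalize hp : potential s.b = p
  generalize hq : d - s.k = q
  induction p using Nat.strong_induction_on generalizing q s with
  | _ p ihp =>
    induction q generalizing s with
    | zero => exact ⟨0, by simp only [Function.iterate_zero, id]; omega, h⟩
    | succ q ihq =>
      obtain ⟨h', hlt | ⟨heq, hk⟩⟩ := h.step (by omega)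
      · obtain ⟨t, ht⟩ := ihp _ (hp ▸ hlt) h' rfl _ rfl
        exact ⟨t + 1, ht⟩
      · obtain ⟨t, ht⟩ := ihq h' (heq.trans hp) (by omega)
        exact ⟨t + 1, ht⟩

/-! ### The length of the first vector of a reduced basis -/

lemma gs_zero {n : ℕ} (b : Fin (n + 1) → Fin N → ℤ) : gs b 0 = toEuclid (b 0) :=
  InnerProductSpace.gramSchmidt_bot ℝ (fun i => toEuclid (b i))

lemma norm_gs_zero_le {n : ℕ} {b : Fin (n + 1) → Fin N → ℤ} (h : ReducedBelow b (n + 1))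
    (m : Fin (n + 1)) : ‖gs b 0‖ ^ 2 ≤ 2 ^ (m : ℕ) * ‖gs b m‖ ^ 2 := by
  induction m using Fin.induction with
  | zero => simp
  | succ j ih =>
    obtain ⟨hmu, hL⟩ := h j.succ j.castSucc (by simp) j.succ.2
    rw [Lovasz] at hL
    have h1 : mu b j.succ j.castSucc ^ 2 ≤ 1 / 4 := by
      rw [← sq_abs]
      nlinarith [abs_nonneg (mu b j.succ j.castSucc)]
    have h2 : ‖gs b j.castSucc‖ ^ 2 ≤ 2 * ‖gs b j.succ‖ ^ 2 := by
      nlinarith [sq_nonneg ‖gs b j.castSucc‖]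
    rw [Fin.val_succ, pow_succ (2 : ℝ), mul_assoc]
    exact ih.trans (mul_le_mul_of_nonneg_left h2 (by positivity))

/-- A nonzero lattice vector is at least as long as some Gram-Schmidt vector, namely that of the
last basis vector with a nonzero coefficient. -/
lemma exists_norm_gs_le (b : Fin d → Fin N → ℤ) (h0 : ∀ l, gs b l ≠ 0) {x : Fin N → ℤ}
    (hx : x ∈ Submodule.span ℤ (Set.range b)) (hx0 : x ≠ 0) :
    ∃ m, ‖gs b m‖ ^ 2 ≤ ‖toEuclid x‖ ^ 2 := by
  obtain ⟨c, rfl⟩ := (Submodule.mem_span_range_iff_exists_fun ℤ).1 hx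
  have hne : (Finset.univ.filter fun l => c l ≠ 0).Nonempty := by
    rw [Finset.nonempty_iff_ne_empty]
    intro hempty
    refine hx0 (Finset.sum_eq_zero fun l _ => ?_)
    have : c l = 0 := by
      by_contra hl
      have : l ∈ (Finset.univ.filter fun l => c l ≠ 0) := by simp [hl]
      simp [hempty] at this
    rw [this, zero_smul]
  obtain ⟨m, hm, hmax⟩ := Finset.exists_max_image _ (fun l : Fin d => l) hne
  simp only [Finset.mem_filter, Finset.mem_univ, true_and] at hm hmax
  refine ⟨m, ?_⟩
  have hlin : toEuclid (∑ l, c l • b l) = ∑ l, (c l : ℝ) • toEuclid (b l) := by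
    ext k
    simp [toEuclid, Finset.sum_apply]
  have hinner : inner ℝ (gs b m) (toEuclid (∑ l, c l • b l)) = c m * ‖gs b m‖ ^ 2 := by
    rw [hlin, inner_sum, Finset.sum_eq_single m]
    · rw [inner_smul_right, inner_gs_self]
    · intro l _ hl
      rcases lt_or_gt_of_ne hl with hlt | hgt
      · rw [inner_smul_right, inner_gs_of_lt b hlt, mul_zero]
      · have : c l = 0 := by
          by_contra hc
          exact absurd (hmax l hc) (not_le.2 hgt)
        simp [this]
    · simp
  have hcs := abs_real_inner_le_norm (gs b m) (toEuclid (∑ l, c l • b l))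
  have hc1 : (1 : ℝ) ≤ |(c m : ℝ)| := by exact_mod_cast Int.one_le_abs hm
  have hpos : 0 < ‖gs b m‖ := norm_pos_iff.2 (h0 m)
  rw [hinner, abs_mul, abs_of_nonneg (sq_nonneg ‖gs b m‖)] at hcs
  have hle : ‖gs b m‖ ≤ ‖toEuclid (∑ l, c l • b l)‖ := by
    refine le_of_mul_le_mul_left (le_trans ?_ hcs) hpos
    rw [← sq]
    exact le_mul_of_one_le_left (sq_nonneg _) hc1
  gcongr

/-- On linearly independent vectors the LLL algorithm terminates, with a first vector that is
nonzero and longer by a factor of at most `2 ^ (n / 2)` than any other nonzero lattice vector. -/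
lemma exists_lllReturns {n : ℕ} (b : Fin (n + 1) → Fin N → ℤ)
    (hb : LinearIndependent ℝ fun i => toEuclid (b i)) :
    ∃ v, LLLReturns b v ∧ v ≠ 0 ∧ v ∈ Submodule.span ℤ (Set.range b) ∧
      ∀ x ∈ Submodule.span ℤ (Set.range b), x ≠ 0 →
        ‖toEuclid v‖ ^ 2 ≤ 2 ^ n * ‖toEuclid x‖ ^ 2 := by
  have hinit : Invariant b (⟨1, b⟩ : LLLState (n + 1) N) :=
    ⟨fun l => InnerProductSpace.gramSchmidt_ne_zero l hb, rfl, le_rfl, by simp,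
      fun i j hij hlt => by simp only at hlt; omega⟩
  obtain ⟨t, hk, h⟩ := hinit.exists_iterate
  refine ⟨_, ⟨t, hk, rfl⟩, ?_, ?_, fun x hx hx0 => ?_⟩
  · intro h0
    refine h.gs_ne_zero 0 ?_
    rw [gs_zero, h0]
    ext
    simp [toEuclid]
  · rw [← h.span_eq]
    exact Submodule.subset_span ⟨0, rfl⟩
  · rw [← h.span_eq] at hx
    obtain ⟨m, hm⟩ := exists_norm_gs_le _ h.gs_ne_zero hx hx0
    have hred : ReducedBelow (lllStep^[t] (⟨1, b⟩ : LLLState (n + 1) N)).b (n + 1) :=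
      fun i j hij hlt => h.reduced i j hij (hlt.trans_le hk)
    rw [← gs_zero]
    refine (norm_gs_zero_le hred m).trans ?_
    gcongr
    · norm_num
    · exact Nat.le_of_lt_succ m.2

/-! ### The subset sum lattice -/

variable {n : ℕ}

lemma latticeMatrix_zero_zero (B₀ : ℤ) (B : Fin n → ℤ) : latticeMatrix B₀ B 0 0 = B₀ := rfl

lemma latticeMatrix_zero_succ (B₀ : ℤ) (B : Fin n → ℤ) (j : Fin n) :
    latticeMatrix B₀ B 0 j.succ = -B j := rfl

lemma latticeMatrix_succ_zero (B₀ : ℤ) (B : Fin n → ℤ) (i : Fin n) :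
    latticeMatrix B₀ B i.succ 0 = 0 := rfl

lemma latticeMatrix_succ_succ (B₀ : ℤ) (B : Fin n → ℤ) (i j : Fin n) :
    latticeMatrix B₀ B i.succ j.succ = if i = j then 1 else 0 :=
  Matrix.one_apply

lemma linearIndependent_col_latticeMatrix {B₀ : ℤ} (hB₀ : B₀ ≠ 0) (B : Fin n → ℤ) :
    LinearIndependent ℝ fun j => toEuclid ((latticeMatrix B₀ B).col j) := by
  rw [Fintype.linearIndependent_iff]
  intro g hg
  have hcoord : ∀ k, ∑ l, g l * (latticeMatrix B₀ B k l : ℝ) = 0 := fun k => by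
    have := congrArg (fun v : EuclideanSpace ℝ (Fin (n + 1)) => v k) hg
    simpa [toEuclid, Matrix.col_apply] using this
  have hsucc : ∀ i : Fin n, g i.succ = 0 := fun i => by
    have := hcoord i.succ
    simpa [Fin.sum_univ_succ, latticeMatrix_succ_zero, latticeMatrix_succ_succ] using this
  have hzero : g 0 = 0 := by
    have := hcoord 0
    simpa [Fin.sum_univ_succ, latticeMatrix_zero_zero, hsucc, hB₀] using this
  exact fun i => Fin.cases hzero hsucc i

lemma mem_span_col_latticeMatrix {B₀ : ℤ} {B : Fin n → ℤ} {v : Fin (n + 1) → ℤ} :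
    v ∈ Submodule.span ℤ (Set.range fun j => (latticeMatrix B₀ B).col j) ↔
      ∃ y : ℤ, v 0 = y * B₀ - ∑ i : Fin n, v i.succ * B i := by
  rw [Submodule.mem_span_range_iff_exists_fun]
  constructor
  · rintro ⟨c, rfl⟩
    refine ⟨c 0, ?_⟩
    simp [Fin.sum_univ_succ, latticeMatrix_zero_zero, latticeMatrix_zero_succ,
      latticeMatrix_succ_zero, latticeMatrix_succ_succ, Matrix.col_apply, sub_eq_add_neg]
  · rintro ⟨y, hy⟩
    refine ⟨Fin.cons y fun i => v i.succ, ?_⟩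
    ext k
    refine Fin.cases ?_ (fun i => ?_) k
    · simp [Fin.sum_univ_succ, latticeMatrix_zero_zero, latticeMatrix_zero_succ, hy,
        Matrix.col_apply, sub_eq_add_neg]
    · simp [Fin.sum_univ_succ, latticeMatrix_succ_zero, latticeMatrix_succ_succ,
        Matrix.col_apply]

lemma norm_toEuclid_sq {N : ℕ} (v : Fin N → ℤ) : ‖toEuclid v‖ ^ 2 = ∑ i, (v i : ℝ) ^ 2 := by
  simp [toEuclid, EuclideanSpace.norm_sq_eq]

lemma HalfCondition.target_pos {e B : Fin n → ℤ} (hn : 0 < n) (hB : ∀ i, 1 ≤ B i)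
    (h : HalfCondition e B) : 0 < target e B := by
  have : Nonempty (Fin n) := ⟨⟨0, hn⟩⟩
  have h1 : (0 : ℝ) < ∑ i, (B i : ℝ) :=
    Finset.sum_pos (fun i _ => by exact_mod_cast hB i) Finset.univ_nonempty
  have h2 : (0 : ℝ) < target e B := lt_of_lt_of_le (by linarith) h
  exact_mod_cast h2

/-- The deterministic part of the argument: if no short integer vector `(y, w, x)` with `x ≠ y e`
satisfies the linear relation that makes `(w; x)` a lattice vector, then the LLL algorithm finds
`e`. The condition `B₀ ≥ (1/2) ∑ Bᵢ` is what bounds the coefficient `y` of the first column. -/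
lemma lllFinds_of_forall_eq_zero (hn : 0 < n) {e B : Fin n → ℤ} (he : ∀ i, e i = 0 ∨ e i = 1)
    (hB : ∀ i, 1 ≤ B i) (hH : HalfCondition e B) {K : ℤ} {R : ℝ} (hR0 : 0 ≤ R)
    (hR : n * 2 ^ n ≤ R ^ 2) (hK : 3 * R ≤ K)
    (h : ∀ (y w : ℤ) (x : Fin n → ℤ), |y| ≤ K → |w| ≤ K → (∀ i, |x i| ≤ K) →
      ∑ i, B i * (y * e i - x i) = w → ∀ i, y * e i - x i = 0) :
    LLLFinds (target e B) B e := by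
  have htpos := hH.target_pos hn hB
  obtain ⟨v, hv, hv0, hvmem, hshort⟩ :=
    exists_lllReturns _ (linearIndependent_col_latticeMatrix htpos.ne' B)
  obtain ⟨y, hy⟩ := mem_span_col_latticeMatrix.1 hvmem
  have hmem : (Fin.cons 0 e : Fin (n + 1) → ℤ) ∈
      Submodule.span ℤ (Set.range fun j => (latticeMatrix (target e B) B).col j) :=
    mem_span_col_latticeMatrix.2 ⟨1, by simp [target, mul_comm]⟩
  have hne : (Fin.cons 0 e : Fin (n + 1) → ℤ) ≠ 0 := by
    intro h0
    have he0 : e = 0 := funext fun i => by simpa using congrFun h0 i.succ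
    simp [target, he0] at htpos
  have hnorm : ‖toEuclid v‖ ^ 2 ≤ R ^ 2 := by
    have h1 : ‖toEuclid (Fin.cons 0 e : Fin (n + 1) → ℤ)‖ ^ 2 ≤ n := by
      rw [norm_toEuclid_sq, Fin.sum_univ_succ]
      calc _ ≤ ∑ i : Fin n, (1 : ℝ) := by
            simp only [Fin.cons_zero, Fin.cons_succ, Int.cast_zero, ne_eq, OfNat.ofNat_ne_zero,
              not_false_eq_true, zero_pow, zero_add]
            refine Finset.sum_le_sum fun i _ => ?_
            rcases he i with h | h <;> simp [h]
        _ = n := by simp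
    calc ‖toEuclid v‖ ^ 2 ≤ 2 ^ n * ‖toEuclid (Fin.cons 0 e : Fin (n + 1) → ℤ)‖ ^ 2 :=
          hshort _ hmem hne
      _ ≤ 2 ^ n * n := by gcongr
      _ ≤ R ^ 2 := by rwa [mul_comm]
  have hcoord : ∀ k, |(v k : ℝ)| ≤ R := fun k => by
    refine abs_le_of_sq_le_sq (le_trans ?_ hnorm) hR0
    rw [norm_toEuclid_sq]
    exact Finset.single_le_sum (f := fun k => (v k : ℝ) ^ 2) (fun k _ => sq_nonneg _)
      (Finset.mem_univ k)
  have hcoordK : ∀ k, |v k| ≤ K := fun k => by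
    have h1 : (|v k| : ℝ) ≤ K := (hcoord k).trans (by linarith)
    exact_mod_cast h1
  have hyK : |y| ≤ K := by
    have ht : (0 : ℝ) < target e B := by exact_mod_cast htpos
    have ht1 : (1 : ℝ) ≤ target e B := by exact_mod_cast htpos
    have h1 : (y : ℝ) * target e B = v 0 + ∑ i : Fin n, (v i.succ : ℝ) * B i := by
      rw [eq_comm, ← eq_sub_iff_add_eq]
      exact_mod_cast hy
    have h2 : |∑ i : Fin n, (v i.succ : ℝ) * B i| ≤ R * ∑ i, (B i : ℝ) := by
      rw [Finset.mul_sum]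
      refine (Finset.abs_sum_le_sum_abs _ _).trans (Finset.sum_le_sum fun i _ => ?_)
      have hBi : (0 : ℝ) ≤ B i := by exact_mod_cast (zero_le_one.trans (hB i))
      rw [abs_mul, abs_of_nonneg hBi]
      exact mul_le_mul_of_nonneg_right (hcoord _) hBi
    have h3 : |(y : ℝ)| * target e B ≤ 3 * R * target e B := by
      calc |(y : ℝ)| * target e B = |(y : ℝ) * target e B| := by
            rw [abs_mul, abs_of_pos ht]
        _ ≤ |(v 0 : ℝ)| + |∑ i : Fin n, (v i.succ : ℝ) * B i| := by
            rw [h1]; exact abs_add_le _ _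
        _ ≤ R + R * ∑ i, (B i : ℝ) := add_le_add (hcoord 0) h2
        _ ≤ R * target e B + R * (2 * target e B) := by
            have hH' : ∑ i, (B i : ℝ) ≤ 2 * target e B := by
              unfold HalfCondition at hH
              linarith
            gcongr
            exact le_mul_of_one_le_right hR0 ht1
        _ = 3 * R * target e B := by ring
    have h4 : (|y| : ℝ) ≤ K := (le_of_mul_le_mul_right h3 ht).trans hK
    exact_mod_cast h4
  have hrel : ∑ i, B i * (y * e i - v i.succ) = v 0 := by
    rw [hy, target, Finset.mul_sum, ← Finset.sum_sub_distrib]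
    exact Finset.sum_congr rfl fun i _ => by ring
  have hzero := h y (v 0) (fun i => v i.succ) hyK (hcoordK 0) (fun i => hcoordK _) hrel
  have hveq : v = y • (Fin.cons 0 e : Fin (n + 1) → ℤ) := by
    ext k
    refine Fin.cases ?_ (fun i => ?_) k
    · simp [← hrel, hzero]
    · simp only [Pi.smul_apply, Fin.cons_succ, smul_eq_mul]
      exact (sub_eq_zero.1 (hzero i)).symm
  refine ⟨v, hv, y, ?_, hveq⟩
  rintro rfl
  exact hv0 (by rw [hveq, zero_smul])

/-! ### Counting inputs -/

/-- The set of possible inputs: all vectors with entries in `[1, M]`. -/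
noncomputable def inputBox (n : ℕ) (M : ℤ) : Finset (Fin n → ℤ) :=
  Fintype.piFinset fun _ => Finset.Icc 1 M

lemma mem_inputBox {M : ℤ} {B : Fin n → ℤ} : B ∈ inputBox n M ↔ ∀ i, 1 ≤ B i ∧ B i ≤ M := by
  simp [inputBox]

lemma card_inputBox (n : ℕ) {M : ℤ} (hM : 0 ≤ M) : ((inputBox n M).card : ℝ) = (M : ℝ) ^ n := by
  have h1 : ((M.toNat : ℤ) : ℝ) = M := by rw [Int.toNat_of_nonneg hM]
  rw [inputBox, Fintype.card_piFinset_const, Int.card_Icc, add_sub_cancel_right, Nat.cast_pow,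
    ← h1, Int.cast_natCast]

/-- A nontrivial linear equation holds for a proportion of at most `1 / M` of the inputs: one
coordinate is determined by the others. -/
lemma card_filter_sum_eq_mul_le {M : ℤ} (hM : 0 ≤ M) {z : Fin n → ℤ} {i : Fin n} (hz : z i ≠ 0)
    (w : ℤ) : (((inputBox n M).filter fun B => ∑ j, B j * z j = w).card : ℝ) * M
      ≤ (inputBox n M).card := by
  have h1 : ((Finset.Icc 1 M).card : ℝ) = M := by
    have h1 : ((M.toNat : ℤ) : ℝ) = M := by rw [Int.toNat_of_nonneg hM]
    rw [Int.card_Icc, add_sub_cancel_right, ← h1, Int.cast_natCast]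
  rw [← h1, ← Nat.cast_mul, ← Finset.card_product, Nat.cast_le]
  -- Solutions paired with an arbitrary value `t` inject into the inputs: replace `B i` by `t`.
  refine Finset.card_le_card_of_injOn (fun p => Function.update p.1 i p.2) ?_ ?_
  · rintro ⟨B, t⟩ hp
    simp only [Finset.coe_product, Set.mem_prod, Finset.mem_coe, Finset.mem_filter, mem_inputBox,
      Finset.mem_Icc] at hp ⊢
    intro j
    rcases eq_or_ne j i with rfl | hj
    · simpa using hp.2
    · simpa [hj] using hp.1.1 j
  · rintro ⟨B, t⟩ hp ⟨B', t'⟩ hp' heq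
    simp only [Finset.coe_product, Set.mem_prod, Finset.mem_coe, Finset.mem_filter] at hp hp' heq
    have ht : t = t' := by simpa using congrFun heq i
    have hoff : ∀ j, j ≠ i → B j = B' j := fun j hj => by simpa [hj] using congrFun heq j
    have hon : B i = B' i := by
      have h2 := hp.1.2.trans hp'.1.2.symm
      rw [← Finset.add_sum_erase _ _ (Finset.mem_univ i),
        ← Finset.add_sum_erase _ (fun j => B' j * z j) (Finset.mem_univ i),
        Finset.sum_congr rfl fun j hj => by rw [hoff j (Finset.ne_of_mem_erase hj)]] at h2
      exact mul_right_cancel₀ hz (add_right_cancel h2)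
    have hBB : B = B' := funext fun j => by
      rcases eq_or_ne j i with rfl | hj
      · exact hon
      · exact hoff j hj
    rw [ht, hBB]

open Classical in
/-- The inputs that satisfy `B₀ ≥ (1/2) ∑ Bᵢ` and on which the LLL algorithm fails to find `e`. -/
noncomputable def failures (e : Fin n → ℤ) (M : ℤ) : Finset (Fin n → ℤ) :=
  (inputBox n M).filter fun B => HalfCondition e B ∧ ¬ LLLFinds (target e B) B e

/-- Union bound over all short candidates for a lattice vector. -/
lemma card_failures_mul_le (hn : 0 < n) {e : Fin n → ℤ} (he : ∀ i, e i = 0 ∨ e i = 1) {M : ℤ}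
    (hM : 0 ≤ M) {K : ℕ} {R : ℝ} (hR0 : 0 ≤ R) (hR : n * 2 ^ n ≤ R ^ 2) (hK : 3 * R ≤ K) :
    ((failures e M).card : ℝ) * M ≤ (2 * K + 1) ^ (n + 2) * (inputBox n M).card := by
  classical
  set I : Finset ℤ := Finset.Icc (-K) K with hI
  have hmemI : ∀ t : ℤ, t ∈ I ↔ |t| ≤ K := fun t => by rw [hI, Finset.mem_Icc, abs_le]
  set T : Finset (ℤ × ℤ × (Fin n → ℤ)) := I ×ˢ I ×ˢ Fintype.piFinset fun _ => I with hT
  have hTcard : (T.card : ℝ) = (2 * K + 1) ^ (n + 2) := by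
    have hIcard : I.card = 2 * K + 1 := by rw [hI, Int.card_Icc]; omega
    rw [hT, Finset.card_product, Finset.card_product, Fintype.card_piFinset_const, hIcard]
    push_cast
    ring
  set T' := T.filter fun p => ∃ i, p.1 * e i - p.2.2 i ≠ 0 with hT'
  have hsub : failures e M ⊆ T'.biUnion fun p =>
      (inputBox n M).filter fun B => ∑ j, B j * (p.1 * e j - p.2.2 j) = p.2.1 := by
    intro B hB
    simp only [failures, Finset.mem_filter] at hB
    obtain ⟨hbox, hH, hfail⟩ := hB
    by_contra hnot
    refine hfail (lllFinds_of_forall_eq_zero hn he (fun i => (mem_inputBox.1 hbox i).1) hH hR0 hR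
      (K := K) (by exact_mod_cast hK) fun y w x hy hw hx hrel => ?_)
    by_contra! hne
    refine hnot (Finset.mem_biUnion.2 ⟨(y, w, x), ?_, Finset.mem_filter.2 ⟨hbox, hrel⟩⟩)
    simp only [hT', hT, Finset.mem_filter, Finset.mem_product, Fintype.mem_piFinset, hmemI]
    exact ⟨⟨hy, hw, hx⟩, hne⟩
  have hM' : (0 : ℝ) ≤ M := by exact_mod_cast hM
  calc ((failures e M).card : ℝ) * M
      ≤ (∑ p ∈ T', (((inputBox n M).filter fun B =>
          ∑ j, B j * (p.1 * e j - p.2.2 j) = p.2.1).card : ℝ)) * M := by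
        refine mul_le_mul_of_nonneg_right ?_ hM'
        exact_mod_cast (Finset.card_le_card hsub).trans Finset.card_biUnion_le
    _ ≤ ∑ p ∈ T', ((inputBox n M).card : ℝ) := by
        rw [Finset.sum_mul]
        refine Finset.sum_le_sum fun p hp => ?_
        obtain ⟨i, hi⟩ := (Finset.mem_filter.1 hp).2
        exact card_filter_sum_eq_mul_le hM hi p.2.1
    _ ≤ (2 * K + 1) ^ (n + 2) * (inputBox n M).card := by
        rw [Finset.sum_const, nsmul_eq_mul, ← hTcard]
        gcongr
        exact Finset.filter_subset _ _

open Classical in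
/-- The condition `B₀ ≥ (1/2) ∑ Bᵢ` holds for a proportion of at least `(4 n) ^ (-n)` of the
inputs. Indeed, it holds if `e i = 1` and `B i` exceeds `n` times a bound on the other entries. -/
lemma card_inputBox_le_mul_card_filter_half {e : Fin n → ℤ} (he : ∀ i, e i = 0 ∨ e i = 1)
    (he0 : e ≠ 0) {M : ℤ} (hM : 2 * n ≤ M) :
    ((inputBox n M).card : ℝ)
      ≤ (4 * n) ^ n * ((inputBox n M).filter fun B => HalfCondition e B).card := by
  obtain ⟨i, hi⟩ := Function.ne_iff.1 he0
  have hi1 : e i = 1 := (he i).resolve_left hi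
  have hn : (1 : ℤ) ≤ n := by exact_mod_cast i.pos
  set m : ℤ := M / (2 * n) with hm
  have hm1 : 1 ≤ m := by
    rw [hm, Int.le_ediv_iff_mul_le (by omega)]
    omega
  have hmM : 2 * n * m ≤ M := Int.mul_ediv_self_le (by omega)
  have hMm : M ≤ 4 * n * m := by
    have h1 : M < (m + 1) * (2 * n) := Int.lt_ediv_add_one_mul_self M (by omega)
    nlinarith
  set c : Fin n → ℤ := Pi.single i (n * m) with hc
  have hci : c i = n * m := by simp [hc]
  have hcj : ∀ j, j ≠ i → c j = 0 := fun j hj => by simp [hc, hj]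
  set S : Finset (Fin n → ℤ) := Fintype.piFinset fun j => Finset.Icc (c j + 1) (c j + m) with hS
  have hScard : (S.card : ℝ) = (m : ℝ) ^ n := by
    have h1 : ∀ j, (Finset.Icc (c j + 1) (c j + m)).card = m.toNat := fun j => by
      rw [Int.card_Icc]
      congr 1
      ring
    have h2 : ((m.toNat : ℤ) : ℝ) = m := by rw [Int.toNat_of_nonneg (by omega)]
    rw [hS, Fintype.card_piFinset]
    simp only [h1, Finset.prod_const, Finset.card_univ, Fintype.card_fin]
    rw [← h2]
    push_cast
    rfl
  have hsub : S ⊆ (inputBox n M).filter fun B => HalfCondition e B := by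
    intro B hB
    simp only [hS, Fintype.mem_piFinset, Finset.mem_Icc] at hB
    have hpos : ∀ j, 1 ≤ B j := fun j => by
      have h1 := (hB j).1
      rcases eq_or_ne j i with rfl | hj
      · rw [hci] at h1
        nlinarith
      · rw [hcj j hj] at h1
        omega
    refine Finset.mem_filter.2 ⟨mem_inputBox.2 fun j => ⟨hpos j, ?_⟩, ?_⟩
    · have h1 := (hB j).2
      rcases eq_or_ne j i with rfl | hj
      · rw [hci] at h1
        nlinarith
      · rw [hcj j hj] at h1
        nlinarith
    · have htarget : B i ≤ target e B := by
        have h1 := Finset.single_le_sum (f := fun j => B j * e j) (s := Finset.univ)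
          (fun j _ => mul_nonneg (zero_le_one.trans (hpos j))
            (by rcases he j with h | h <;> simp [h])) (Finset.mem_univ i)
        simpa [hi1, target] using h1
      have hrest : ∑ j ∈ Finset.univ.erase i, B j ≤ n * m := by
        calc ∑ j ∈ Finset.univ.erase i, B j ≤ ∑ j ∈ Finset.univ.erase i, m := by
              refine Finset.sum_le_sum fun j hj => ?_
              have h1 := (hB j).2
              rw [hcj j (Finset.ne_of_mem_erase hj)] at h1
              omega
          _ ≤ n * m := by
              rw [Finset.sum_const, nsmul_eq_mul]
              refine mul_le_mul_of_nonneg_right ?_ (by omega)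
              have := Finset.card_le_univ (Finset.univ.erase i : Finset (Fin n))
              rw [Fintype.card_fin] at this
              exact_mod_cast this
      have hsum : ∑ j, B j ≤ 2 * target e B := by
        rw [← Finset.add_sum_erase _ _ (Finset.mem_univ i)]
        have h1 := (hB i).1
        rw [hci] at h1
        omega
      have hsum' : ∑ j, (B j : ℝ) ≤ 2 * target e B := by exact_mod_cast hsum
      unfold HalfCondition
      linarith
  have hm0 : (0 : ℝ) ≤ m := by exact_mod_cast (by omega : 0 ≤ m)
  have hM0 : (0 : ℝ) ≤ M := by exact_mod_cast (by omega : 0 ≤ M)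
  calc ((inputBox n M).card : ℝ) = (M : ℝ) ^ n := card_inputBox n (by omega)
    _ ≤ (4 * n * m) ^ n := by
        gcongr
        exact_mod_cast hMm
    _ = (4 * n) ^ n * S.card := by rw [hScard, mul_pow]
    _ ≤ _ := by
        gcongr

/-! ### The law of the input -/

open MeasureTheory ProbabilityTheory

lemma pi_uniformOn_eq (s : Finset ℤ) :
    Measure.pi (fun _ : Fin n => uniformOn (s : Set ℤ))
      = uniformOn ((Fintype.piFinset fun _ => s : Finset (Fin n → ℤ)) : Set (Fin n → ℤ)) := by
  refine Measure.ext_of_singleton fun f => ?_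
  have h1 : ∀ t : ℤ, uniformOn (s : Set ℤ) {t} = ((s ∩ {t}).card : ENNReal) / s.card := fun t => by
    rw [← Finset.coe_singleton, uniformOn_apply_finset]
  have h2 : ({f} : Finset (Fin n → ℤ)) = Fintype.piFinset fun i => {f i} := by
    rw [Fintype.piFinset_singleton]
  rw [Measure.pi_singleton, ← Finset.coe_singleton, uniformOn_apply_finset, h2,
    ← Fintype.piFinset_inter, Fintype.card_piFinset, Fintype.card_piFinset]
  simp only [h1]
  rw [ENNReal.prod_div_distrib_of_ne_top (by simp)]
  push_cast
  rfl

open Classical in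
lemma pi_uniformOn_real_apply (M : ℤ) (A : Set (Fin n → ℤ)) :
    (Measure.pi (fun _ : Fin n => uniformOn (Set.Icc 1 M))).real A
      = ((inputBox n M).filter fun B => B ∈ A).card / (inputBox n M).card := by
  have h1 : ((inputBox n M : Finset (Fin n → ℤ)) : Set (Fin n → ℤ)) ∩ A
      = (((inputBox n M).filter fun B => B ∈ A : Finset (Fin n → ℤ)) : Set (Fin n → ℤ)) := by
    ext; simp
  rw [← Finset.coe_Icc, pi_uniformOn_eq, Measure.real,
    ← uniformOn_inter_self (Finset.finite_toSet _)]
  change (uniformOn ((inputBox n M : Finset (Fin n → ℤ)) : Set (Fin n → ℤ)) (_ ∩ A)).toReal = _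
  rw [inputBox] at h1 ⊢
  rw [h1, uniformOn_apply_finset, Finset.inter_filter, Finset.inter_self, ENNReal.toReal_div]
  simp

/-! ### Comparison of the failure count with the number of inputs -/

/-- Polynomial against exponential growth, with the powers that the union bound produces. -/
lemma eventually_pow_le (ε : ℝ) (hε : 0 < ε) : ∃ n₀ : ℕ, ∀ n : ℕ, n₀ < n →
    (9 * n : ℝ) ^ 5 ≤ ((2 : ℝ) ^ (ε / 2)) ^ n := by
  have h1 : 1 < (2 : ℝ) ^ (ε / 2) := Real.one_lt_rpow (by norm_num) (by positivity)
  have h2 := (tendsto_pow_const_div_const_pow_of_one_lt 5 h1).eventually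
    (gt_mem_nhds (show (0 : ℝ) < 1 / 9 ^ 5 by norm_num))
  obtain ⟨n₀, hn₀⟩ := Filter.eventually_atTop.1 h2
  refine ⟨n₀, fun n hn => ?_⟩
  have h3 := hn₀ n hn.le
  rw [div_lt_div_iff₀ (by positivity) (by positivity)] at h3
  rw [mul_pow]
  linarith

/-- The number `(2 K + 1) ^ (n + 2)` of candidates is smaller than `M` even after multiplication by
the inverse of the lower bound `(4 n) ^ (-n)` for the probability of the condition. -/
lemma exists_forall_count_le (ε : ℝ) (hε : 0 < ε) : ∃ n₀ : ℕ, ∀ n : ℕ, n₀ < n →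
    ∃ (K : ℕ) (R : ℝ), 0 ≤ R ∧ n * 2 ^ n ≤ R ^ 2 ∧ 3 * R ≤ K ∧
      2 * (2 * K + 1) ^ (n + 2) * (4 * n) ^ n ≤ (2 : ℝ) ^ (-(ε * (n : ℝ) ^ 2 / 2)) *
        ⌊(2 : ℝ) ^ ((1 / 2 + ε) * (n : ℝ) ^ 2)⌋ := by
  obtain ⟨n₀, hn₀⟩ := eventually_pow_le ε hε
  refine ⟨n₀, fun n hn => ?_⟩
  have hn1 : 1 ≤ n := by omega
  have hn1' : (1 : ℝ) ≤ n := by exact_mod_cast hn1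
  set q : ℝ := (2 : ℝ) ^ ((n : ℝ) / 2) with hq
  have hqn : ∀ k : ℕ, q ^ k = (2 : ℝ) ^ ((n : ℝ) / 2 * k) := fun k => by
    rw [hq, ← Real.rpow_natCast, ← Real.rpow_mul (by norm_num)]
  have hq1 : 1 ≤ q := Real.one_le_rpow (by norm_num) (by positivity)
  have hq2 : q ^ 2 = 2 ^ n := by
    rw [hqn, ← Real.rpow_natCast]
    congr 1
    push_cast
    ring
  have hR1 : 1 ≤ (n : ℝ) * q := one_le_mul_of_one_le_of_one_le hn1' hq1
  refine ⟨⌈3 * (n * q)⌉₊, n * q, by positivity, ?_, Nat.le_ceil _, ?_⟩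
  · rw [mul_pow, hq2]
    gcongr
    nlinarith
  have hK : 2 * (⌈3 * (n * q)⌉₊ : ℝ) + 1 ≤ 9 * n * q := by
    have := Nat.ceil_lt_add_one (show (0 : ℝ) ≤ 3 * (n * q) by positivity)
    linarith
  set X : ℝ := (2 : ℝ) ^ ((1 / 2 + ε) * (n : ℝ) ^ 2) with hX
  have hX1 : 1 ≤ X := Real.one_le_rpow (by norm_num) (by positivity)
  have hfloor : X / 2 ≤ (⌊X⌋ : ℝ) := by
    have h1 : (1 : ℝ) ≤ ⌊X⌋ := by exact_mod_cast Int.le_floor.2 (by simpa using hX1)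
    have h2 := Int.lt_floor_add_one X
    linarith
  -- `q ^ (n + 2) = 2 ^ (n² / 2) * 2 ^ n`, so that the powers `2 ^ (n² / 2)` cancel.
  have hqpow : q ^ (n + 2) = (2 : ℝ) ^ ((n : ℝ) ^ 2 / 2) * 2 ^ n := by
    rw [pow_add, hq2, hqn]
    congr 2
    ring
  have hsplit : (2 : ℝ) ^ (-(ε * (n : ℝ) ^ 2 / 2)) * X
      = (2 : ℝ) ^ ((n : ℝ) ^ 2 / 2) * (((2 : ℝ) ^ (ε / 2)) ^ n) ^ n := by
    rw [hX, ← Real.rpow_add (by norm_num), ← pow_mul, ← Real.rpow_natCast (_ ^ _) (n * n),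
      ← Real.rpow_mul (by norm_num), ← Real.rpow_add (by norm_num)]
    congr 1
    push_cast
    ring
  have hpoly : 4 * ((9 * n : ℝ) ^ (n + 2) * 2 ^ n * (4 * n) ^ n)
      ≤ (((2 : ℝ) ^ (ε / 2)) ^ n) ^ n := by
    calc 4 * ((9 * n : ℝ) ^ (n + 2) * 2 ^ n * (4 * n) ^ n)
        = 4 * (9 * n : ℝ) ^ (n + 2) * (8 * n) ^ n := by
          rw [show (8 * n : ℝ) = 2 * (4 * n) by ring, mul_pow 2]
          ring
      _ ≤ (9 * n) * (9 * n : ℝ) ^ (n + 2) * (9 * n) ^ n := by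
          gcongr
          · linarith
          · norm_num
      _ = (9 * n : ℝ) ^ (2 * n + 3) := by ring
      _ ≤ (9 * n : ℝ) ^ (5 * n) := pow_le_pow_right₀ (by linarith) (by omega)
      _ = ((9 * n : ℝ) ^ 5) ^ n := pow_mul _ _ _
      _ ≤ _ := by
          gcongr
          exact hn₀ n hn
  calc 2 * (2 * (⌈3 * (n * q)⌉₊ : ℝ) + 1) ^ (n + 2) * (4 * n) ^ n
      ≤ 2 * (9 * n * q) ^ (n + 2) * (4 * n) ^ n := by gcongr
    _ = (2 : ℝ) ^ ((n : ℝ) ^ 2 / 2) *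
          (4 * ((9 * n : ℝ) ^ (n + 2) * 2 ^ n * (4 * n) ^ n)) / 2 := by
        rw [mul_pow (9 * (n : ℝ)), hqpow]
        ring
    _ ≤ (2 : ℝ) ^ ((n : ℝ) ^ 2 / 2) * (((2 : ℝ) ^ (ε / 2)) ^ n) ^ n / 2 := by gcongr
    _ = (2 : ℝ) ^ (-(ε * (n : ℝ) ^ 2 / 2)) * (X / 2) := by rw [← hsplit]; ring
    _ ≤ _ := by gcongr

lemma target_one_sub {n : ℕ} (e B : Fin n → ℤ) :
    target (fun i => 1 - e i) B = ∑ i, B i - target e B := by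
  simp [target, mul_sub]

lemma halfCondition_one_sub {n : ℕ} {e B : Fin n → ℤ} (h : ¬ HalfCondition e B) :
    HalfCondition (fun i => 1 - e i) B := by
  unfold HalfCondition at h ⊢
  rw [target_one_sub]
  push_cast
  linarith

end SubsetSumLLL

open MeasureTheory ProbabilityTheory SubsetSumLLL in
theorem theorem1 (ε : ℝ) (hε : 0 < ε) :
    ∃ n₀ : ℕ, ∀ n : ℕ, n₀ < n → ∀ e : Fin n → ℤ, (∀ i, e i = 0 ∨ e i = 1) →
      -- conditionally on `B₀ ≥ (1/2) ∑ Bᵢ` (an event of probability zero if `e = 0`)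
      (e ≠ 0 →
        1 - (2 : ℝ) ^ (-(ε * (n : ℝ) ^ 2 / 2)) ≤
          (ProbabilityTheory.cond (SubsetSumLLL.inputLaw n ε)
            {B | SubsetSumLLL.HalfCondition e B}).real
            {B | SubsetSumLLL.LLLFinds (SubsetSumLLL.target e B) B e}) ∧
      -- unconditionally, where the flipped problem is solved if the condition fails
      1 - (2 : ℝ) ^ (-(ε * (n : ℝ) ^ 2 / 2)) ≤
        (SubsetSumLLL.inputLaw n ε).real
          {B | (SubsetSumLLL.HalfCondition e B ∧
                  SubsetSumLLL.LLLFinds (SubsetSumLLL.target e B) B e) ∨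
               (¬ SubsetSumLLL.HalfCondition e B ∧
                  SubsetSumLLL.LLLFinds ((∑ i, B i) - SubsetSumLLL.target e B) B
                    (fun i => 1 - e i))} := by
  classical
  obtain ⟨n₀, hn₀⟩ := exists_forall_count_le ε hε
  refine ⟨n₀, fun n hn e he => ?_⟩
  have hn0 : 0 < n := by omega
  have hn1 : (1 : ℝ) ≤ n := by exact_mod_cast hn0
  obtain ⟨K, R, hR0, hR, hK, hcount⟩ := hn₀ n hn
  set M : ℤ := ⌊(2 : ℝ) ^ ((1 / 2 + ε) * (n : ℝ) ^ 2)⌋ with hM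
  set δ : ℝ := (2 : ℝ) ^ (-(ε * (n : ℝ) ^ 2 / 2)) with hδ
  have hδ0 : 0 < δ := by positivity
  have hδ1 : δ ≤ 1 := Real.rpow_le_one_of_one_le_of_nonpos (by norm_num)
    (by rw [neg_nonpos]; positivity)
  have hM0 : 0 ≤ M := Int.floor_nonneg.2 (by positivity)
  have hM0' : (0 : ℝ) ≤ M := by exact_mod_cast hM0
  have h4n : 1 ≤ (4 * n : ℝ) ^ n := one_le_pow₀ (by linarith)
  have hKpow : (1 : ℝ) ≤ (2 * K + 1) ^ (n + 2) :=
    one_le_pow₀ (by linarith [(Nat.cast_nonneg K : (0 : ℝ) ≤ K)])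
  have hMn : 2 * (n : ℤ) ≤ M := by
    have h1 : (2 * n : ℝ) ≤ M := by
      calc (2 * n : ℝ) ≤ 2 * 1 * (4 * n) ^ 1 := by linarith
        _ ≤ 2 * (2 * K + 1) ^ (n + 2) * (4 * n) ^ n := by
            gcongr
            · linarith
            · exact hn0
        _ ≤ δ * M := hcount
        _ ≤ M := mul_le_of_le_one_left hM0' hδ1
    exact_mod_cast h1
  have hMpos : (0 : ℝ) < M := by
    have : 0 < M := by omega
    exact_mod_cast this
  have hbox : (0 : ℝ) < (inputBox n M).card := by
    rw [card_inputBox n hM0]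
    positivity
  have hfail : ∀ f : Fin n → ℤ, (∀ i, f i = 0 ∨ f i = 1) →
      2 * ((failures f M).card : ℝ) * (4 * n) ^ n ≤ δ * (inputBox n M).card := fun f hf => by
    have h1 := card_failures_mul_le hn0 hf hM0 hR0 hR hK
    refine le_of_mul_le_mul_right ?_ hMpos
    calc 2 * ((failures f M).card : ℝ) * (4 * n) ^ n * M
        = 2 * (4 * n) ^ n * ((failures f M).card * M) := by ring
      _ ≤ 2 * (4 * n) ^ n * ((2 * K + 1) ^ (n + 2) * (inputBox n M).card) := by gcongr
      _ = (2 * (2 * K + 1) ^ (n + 2) * (4 * n) ^ n) * (inputBox n M).card := by ring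
      _ ≤ (δ * M) * (inputBox n M).card := by gcongr
      _ = δ * (inputBox n M).card * M := by ring
  have hreal : ∀ A : Set (Fin n → ℤ), (inputLaw n ε).real A
      = ((inputBox n M).filter fun B => B ∈ A).card / (inputBox n M).card := fun A => by
    rw [inputLaw, ← hM, pi_uniformOn_real_apply]
  constructor
  · intro he0
    have hhalf := card_inputBox_le_mul_card_filter_half he he0 hMn
    set H : Finset (Fin n → ℤ) := (inputBox n M).filter fun B => HalfCondition e B with hH
    have hHpos : (0 : ℝ) < H.card :=
      pos_of_mul_pos_right (hbox.trans_le hhalf) (by positivity)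
    have hcond : (cond (inputLaw n ε) {B | HalfCondition e B}).real
        {B | LLLFinds (target e B) B e}
        = (H.filter fun B => LLLFinds (target e B) B e).card / H.card := by
      have h1 := hreal {B | HalfCondition e B}
      have h2 := hreal ({B | HalfCondition e B} ∩ {B | LLLFinds (target e B) B e})
      rw [Measure.real, cond_apply .of_discrete, ENNReal.toReal_mul, ENNReal.toReal_inv]
      simp only [Measure.real] at h1 h2
      rw [h1, h2, hH, Finset.filter_filter, inv_div]
      simp only [Set.mem_inter_iff, Set.mem_ofPred_eq]
      field_simp
    have hsplit : ((H.filter fun B => LLLFinds (target e B) B e).card : ℝ)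
        + (failures e M).card = H.card := by
      rw [failures, ← Finset.filter_filter, ← hH]
      exact_mod_cast Finset.card_filter_add_card_filter_not _
    rw [hcond, le_div_iff₀ hHpos]
    have h1 : 2 * ((failures e M).card : ℝ) * (4 * n) ^ n ≤ δ * H.card * (4 * n) ^ n :=
      (hfail e he).trans (by rw [mul_assoc, mul_comm (H.card : ℝ)]; gcongr)
    have h2 := le_of_mul_le_mul_right h1 (by positivity)
    linarith [(Nat.cast_nonneg (failures e M).card : (0 : ℝ) ≤ _)]
  · have he' : ∀ i, 1 - e i = 0 ∨ 1 - e i = 1 := fun i => by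
      rcases he i with h | h <;> simp [h]
    rw [hreal, le_div_iff₀ hbox]
    simp only [Set.mem_ofPred_eq]
    set P : (Fin n → ℤ) → Prop := fun B => (HalfCondition e B ∧ LLLFinds (target e B) B e) ∨
      (¬ HalfCondition e B ∧ LLLFinds ((∑ i, B i) - target e B) B (fun i => 1 - e i)) with hP
    have hsub : ((inputBox n M).filter fun B => ¬ P B)
        ⊆ failures e M ∪ failures (fun i => 1 - e i) M := by
      intro B hB
      obtain ⟨hBbox, hBP⟩ := Finset.mem_filter.1 hB
      simp only [hP, not_or, not_and] at hBP
      rw [Finset.mem_union]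
      by_cases hBH : HalfCondition e B
      · exact Or.inl (Finset.mem_filter.2 ⟨hBbox, hBH, hBP.1 hBH⟩)
      · refine Or.inr (Finset.mem_filter.2 ⟨hBbox, halfCondition_one_sub hBH, ?_⟩)
        rw [target_one_sub]
        exact hBP.2 hBH
    have hcard : (((inputBox n M).filter fun B => ¬ P B).card : ℝ)
        ≤ (failures e M).card + (failures (fun i => 1 - e i) M).card := by
      exact_mod_cast (Finset.card_le_card hsub).trans (Finset.card_union_le _ _)
    have hsplit : (((inputBox n M).filter fun B => P B).card : ℝ)
        + ((inputBox n M).filter fun B => ¬ P B).card = (inputBox n M).card := by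
      exact_mod_cast Finset.card_filter_add_card_filter_not _
    have hle : ∀ f : Fin n → ℤ, (∀ i, f i = 0 ∨ f i = 1) →
        2 * ((failures f M).card : ℝ) ≤ δ * (inputBox n M).card := fun f hf =>
      (le_mul_of_one_le_right (by positivity) h4n).trans (hfail f hf)
    have h1 := hle e he
    have h2 := hle _ he'
    change _ ≤ (((inputBox n M).filter fun B => P B).card : ℝ)
    linarith
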